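/- Let $M$ be a Hausdorff smooth manifold (without boundary) of dimension $n \ge 0$, let $C^\infty(M)$ be the ring of smooth functions $M \to \mathbb{R}$, and let $\mathfrak{X}(M)$ be the $C^\infty(M)$-module of smooth vector fields on $M$. A finite family $(X_i)_{i \in I}$ in $\mathfrak{X}(M)$ is called a generating set if every $X \in \mathfrak{X}(M)$ can be written as $X = \sum_{i \in I} f_i X_i$ with $f_i \in C^\infty(M)$. (1) Let $X_1, \dots, X_m \in \mathfrak{X}(M)$ be such that $\operatorname{span}\{X_1(q), \dots, X_m(q)\} = T_qM$ for every $q \in M$. Then $\{X_1, \dots, X_m\}$ is a generating set. (2) If $M$ is second countable, then $\mathfrak{X}(M)$ is a finitely generated $C^\infty(M)$-module. (3) If $M$ is second countable, then $M$ has a trivialising cover by $n+1$ sets, that is, there are open sets $U_0, \dots, U_n$ covering $M$ and, for each $i$, a smooth local frame $E^{(i)}_1, \dots, E^{(i)}_n$ of $TM$ over $U_i$. For any such cover and frames there is a smooth partition of unity $\psi_0, \dots, \psi_n$ with $\operatorname{supp} \psi_i \subseteq U_i$. For every such partition of unity the $n(n+1)$ vector fields $\psi_i E^{(i)}_j$ ($0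 \le i \le n$, $1 \le j \le n$), extended by $0$ outside $U_i$, are smooth on $M$, span every tangent space of $M$ and form a generating set. -/

import Mathlib

open scoped Manifold ContDiff

noncomputable section

/-- The smooth real functions `C^∞(M)` on a manifold modelled on `ℝⁿ`. -/
abbrev SmoothFunction (n : ℕ) (M : Type*) [TopologicalSpace M]
    [ChartedSpace (EuclideanSpace ℝ (Fin n)) M] : Type _ :=
  C^∞⟮𝓡 n, M; 𝓘(ℝ, ℝ), ℝ⟯

/-- The smooth vector fields on a manifold modelled on `ℝⁿ`: smooth sections of its tangent
bundle. -/
abbrev SmoothVectorField (n : ℕ) (M : Type*) [TopologicalSpace M]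
    [ChartedSpace (EuclideanSpace ℝ (Fin n)) M] [IsManifold (𝓡 n) ∞ M] : Type _ :=
  Cₛ^∞⟮𝓡 n; EuclideanSpace ℝ (Fin n), fun x : M => TangentSpace (𝓡 n) x⟯

namespace SmoothVectorField

variable {n : ℕ} {M : Type*} [TopologicalSpace M]
  [ChartedSpace (EuclideanSpace ℝ (Fin n)) M] [IsManifold (𝓡 n) ∞ M]

/-- The pointwise product `(f • X)_x = f(x) X_x` of a smooth function and a smooth vector field. -/
instance instSMulSmoothFunction : SMul (SmoothFunction n M) (SmoothVectorField n M) where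
  smul f X := ⟨fun x => f x • X x, f.contMDiff.smul_section X.contMDiff⟩

theorem smul_apply (f : SmoothFunction n M) (X : SmoothVectorField n M) (x : M) :
    (f • X) x = f x • X x := rfl

/-- The smooth vector fields form a module over the ring of smooth functions, with the pointwise
operations. -/
instance instModuleSmoothFunction : Module (SmoothFunction n M) (SmoothVectorField n M) where
  one_smul X := ContMDiffSection.ext fun x => one_smul ℝ (X x)
  mul_smul f g X := ContMDiffSection.ext fun x => mul_smul (f x) (g x) (X x)
  smul_zero f := ContMDiffSection.ext fun x => smul_zero (f x)
  smul_add f X Y := ContMDiffSection.ext fun x => smul_add (f x) (X x) (Y x)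
  add_smul f g X := ContMDiffSection.ext fun x => add_smul (f x) (g x) (X x)
  zero_smul X := ContMDiffSection.ext fun x => zero_smul ℝ (X x)

/-- The finite family `X` generates the `C^∞(M)`-module of smooth vector fields: every smooth
vector field is a combination of the `X i` with smooth coefficients. -/
def IsGeneratingFamily {ι : Type*} [Fintype ι] (X : ι → SmoothVectorField n M) : Prop :=
  ∀ V : SmoothVectorField n M, ∃ f : ι → SmoothFunction n M, V = ∑ i, f i • X i

/-- The vector fields `X i` span every tangent space. -/
def SpansTangentSpaces {ι : Type*} (X : ι → SmoothVectorField n M) : Prop :=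
  ∀ x : M, Submodule.span ℝ (Set.range fun i => X i x) = ⊤

end SmoothVectorField

/-- `U` is an open cover of `M` that trivialises the tangent bundle: on `U i` the vector fields
`E i 1, …, E i n` form a smooth local frame (their values off `U i` are irrelevant). -/
structure IsTrivialisingCover {n : ℕ} {M : Type*} [TopologicalSpace M]
    [ChartedSpace (EuclideanSpace ℝ (Fin n)) M] [IsManifold (𝓡 n) ∞ M] {ι : Type*}
    (U : ι → Set M) (E : ι → Fin n → (x : M) → TangentSpace (𝓡 n) x) : Prop where
  isOpen : ∀ i, IsOpen (U i)
  iUnion_eq : ⋃ i, U i = Set.univ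
  isLocalFrameOn : ∀ i, IsLocalFrameOn (𝓡 n) (EuclideanSpace ℝ (Fin n)) ∞ (E i) (U i)

end

open Set Filter Topology Bundle

/-! For `v` spanning a Euclidean space, S w = ∑ ⟪v i, w⟫ v i is invertible, so w has coefficients ⟪v
i, S⁻¹ w⟫. They are smooth in (v, w) and unchanged when a linear isomorphism acts on both, so on a
manifold they can be computed in any trivialisation. This gives (1) without a partition of unity.

For the cover, take bump functions f i and levels c i such that at most n equations f i = c i hold
at any point. Baire provides them: n + 1 of the f i map M to a set of dimension at most n in ℝⁿ⁺¹.
Sorting points by which f i are closest to their levels, and by how many, gives n + 1 families of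
disjoint open sets inside chart domains; frames glue over each family. Cut off by a partition of
unity, they span, and (1) applies. -/

/-! ### Linear algebra of spanning families -/

theorem span_range_map_eq_top {ι E : Type*} [NormedAddCommGroup E] [NormedSpace ℝ E]
    {v : ι → E} (hv : Submodule.span ℝ (range v) = ⊤)
    (L : E ≃L[ℝ] E) :
    Submodule.span ℝ (range fun i => L (v i)) = ⊤ := by
  have : (range fun i => L (v i)) = L.toLinearEquiv.toLinearMap '' range v := by
    rw [← range_comp]; rfl
  rw [this, ← Submodule.map_span, hv, Submodule.map_top, LinearEquiv.range]

/-- The operator `w ↦ ∑ i, ⟪v i, w⟫ v i` of a finite family of vectors. -/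
noncomputable def frameOperator {ι E : Type*} [Fintype ι] [NormedAddCommGroup E] [InnerProductSpace ℝ E]
    (v : ι → E) : E →L[ℝ] E :=
  ∑ i, (innerSL ℝ (v i)).smulRight (v i)

section FrameOperator

variable {ι E : Type*} [Fintype ι] [NormedAddCommGroup E] [InnerProductSpace ℝ E]

theorem frameOperator_apply (v : ι → E) (w : E) :
    frameOperator v w = ∑ i, inner ℝ (v i) w • v i := by
  simp [frameOperator]

theorem contDiff_frameOperator : ContDiff ℝ ∞ (frameOperator : (ι → E) → E →L[ℝ] E) := by
  unfold frameOperator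
  refine ContDiff.sum fun i _ => ?_
  exact ((innerSL ℝ).contDiff.comp (contDiff_apply ℝ E i)).smulRight (contDiff_apply ℝ E i)

/-- Pairing S w with w gives ∑ ⟪v i, w⟫², so S w = 0 makes w orthogonal to the span. -/
theorem frameOperator_injective {v : ι → E} (hv : Submodule.span ℝ (range v) = ⊤) :
    Function.Injective (frameOperator v) := by
  refine (injective_iff_map_eq_zero _).2 fun w hw => ?_
  have h : ∑ i, inner ℝ (v i) w * inner ℝ (v i) w = 0 := by
    have := congrArg (fun u => inner ℝ u w) hw
    simpa [frameOperator_apply, sum_inner, inner_smul_left] using this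
  have h0 : ∀ i, inner ℝ (v i) w = 0 := fun i => by
    simpa using (Finset.sum_eq_zero_iff_of_nonneg fun i _ => mul_self_nonneg _).1 h i
      (Finset.mem_univ i)
  have hle : Submodule.span ℝ (range v) ≤ (ℝ ∙ w)ᗮ := by
    rw [Submodule.span_le]
    rintro _ ⟨i, rfl⟩
    rw [SetLike.mem_coe, Submodule.mem_orthogonal_singleton_iff_inner_left]
    exact h0 i
  rw [hv] at hle
  exact inner_self_eq_zero.1
    (Submodule.mem_orthogonal_singleton_iff_inner_left.1 (hle (Submodule.mem_top (x := w))))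

variable [FiniteDimensional ℝ E]

theorem isUnit_frameOperator {v : ι → E} (hv : Submodule.span ℝ (range v) = ⊤) :
    IsUnit (frameOperator v) := by
  have hinj := frameOperator_injective hv
  rw [ContinuousLinearMap.isUnit_iff_bijective]
  exact ⟨hinj, LinearMap.surjective_of_injective (f := (frameOperator v).toLinearMap) hinj⟩

/-- The coefficients of minimal norm that write `w` as a combination of a spanning family `v`. -/
noncomputable def minimalCoeff (v : ι → E) (w : E) (i : ι) : ℝ :=
  inner ℝ (v i) (Ring.inverse (frameOperator v) w)

theorem minimalCoeff_frameOperator {v : ι → E} (hv : Submodule.span ℝ (range v) = ⊤) (u : E)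
    (i : ι) : minimalCoeff v (frameOperator v u) i = inner ℝ (v i) u := by
  rw [minimalCoeff, ← mul_apply_eq_comp,
    Ring.inverse_mul_cancel _ (isUnit_frameOperator hv), one_apply_eq_self]

theorem exists_frameOperator_eq {v : ι → E} (hv : Submodule.span ℝ (range v) = ⊤) (w : E) :
    ∃ u, frameOperator v u = w :=
  (ContinuousLinearMap.isUnit_iff_bijective.1 (isUnit_frameOperator hv)).2 w

theorem sum_minimalCoeff_smul {v : ι → E} (hv : Submodule.span ℝ (range v) = ⊤) (w : E) :
    ∑ i, minimalCoeff v w i • v i = w := by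
  obtain ⟨u, rfl⟩ := exists_frameOperator_eq hv w
  simp_rw [minimalCoeff_frameOperator hv, ← frameOperator_apply]

theorem minimalCoeff_map {v : ι → E} (hv : Submodule.span ℝ (range v) = ⊤) (L : E ≃L[ℝ] E)
    (w : E) (i : ι) : minimalCoeff (fun i => L (v i)) (L w) i = minimalCoeff v w i := by
  have hLv := span_range_map_eq_top hv L
  obtain ⟨u, hu⟩ := exists_frameOperator_eq hLv (L w)
  -- The operators of the two families satisfy S_{Lv} = L ∘ S_v ∘ L*.
  have hw : frameOperator v ((L : E →L[ℝ] E).adjoint u) = w := by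
    apply L.injective
    rw [← hu, frameOperator_apply, frameOperator_apply, map_sum]
    refine Finset.sum_congr rfl fun i _ => ?_
    rw [ContinuousLinearMap.adjoint_inner_right, map_smul]
    rfl
  rw [← hu, minimalCoeff_frameOperator hLv]
  conv_rhs => rw [← hw]
  rw [minimalCoeff_frameOperator hv, ContinuousLinearMap.adjoint_inner_right]
  rfl

/-- Spanning makes the operator a unit, and `Ring.inverse` is smooth at units. -/
theorem contDiffAt_minimalCoeff {v : ι → E} (hv : Submodule.span ℝ (range v) = ⊤) (w : E)
    (i : ι) : ContDiffAt ℝ ∞ (fun p : (ι → E) × E => minimalCoeff p.1 p.2 i) (v, w) := by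
  have hinv : ContDiffAt ℝ ∞ (fun p : (ι → E) × E => Ring.inverse (frameOperator p.1)) (v, w) := by
    obtain ⟨S, hS⟩ := isUnit_frameOperator hv
    refine ContDiffAt.comp (g := Ring.inverse) (v, w) ?_
      (contDiff_frameOperator.comp contDiff_fst).contDiffAt
    simpa only [Function.comp_apply, ← hS] using contDiffAt_ringInverse ℝ S
  have hvi : ContDiffAt ℝ ∞ (fun p : (ι → E) × E => p.1 i) (v, w) :=
    ((contDiff_apply ℝ E i).comp contDiff_fst).contDiffAt
  exact hvi.inner ℝ (hinv.clm_apply contDiffAt_snd)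

end FrameOperator

/-! ### Spanning vector fields generate -/

namespace SmoothVectorField

variable {n : ℕ} {M : Type*} [TopologicalSpace M]
  [ChartedSpace (EuclideanSpace ℝ (Fin n)) M] [IsManifold (𝓡 n) ∞ M]

/-- The inner product of the model fibre need not vary smoothly with x; by `minimalCoeff_map` the
coefficients can be read in one fixed trivialisation near `x₀`. -/
theorem contMDiff_minimalCoeff {ι : Type*} [Fintype ι] {X : ι → SmoothVectorField n M}
    (hX : SpansTangentSpaces X) (V : SmoothVectorField n M) (i : ι) :
    ContMDiff (𝓡 n) 𝓘(ℝ, ℝ) ∞ fun x =>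
      minimalCoeff (E := EuclideanSpace ℝ (Fin n)) (fun i => X i x) (V x) i := by
  intro x₀
  set e := trivializationAt (EuclideanSpace ℝ (Fin n)) (fun x : M => TangentSpace (𝓡 n) x) x₀
    with he
  have hcoord : ∀ W : SmoothVectorField n M,
      ContMDiffAt (𝓡 n) 𝓘(ℝ, EuclideanSpace ℝ (Fin n)) ∞ (fun x => (e ⟨x, W x⟩).2) x₀ :=
    fun W => (contMDiffAt_section x₀).1 (W.contMDiff x₀)
  have hpair : ContMDiffAt (𝓡 n) 𝓘(ℝ, (ι → EuclideanSpace ℝ (Fin n)) × EuclideanSpace ℝ (Fin n)) ∞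
      (fun x => (fun i => (e ⟨x, X i x⟩).2, (e ⟨x, V x⟩).2)) x₀ :=
    (contMDiffAt_pi_space.2 fun i => hcoord (X i)).prodMk_space (hcoord V)
  have hlin : ∀ x ∈ e.baseSet, ∃ L : EuclideanSpace ℝ (Fin n) ≃L[ℝ] EuclideanSpace ℝ (Fin n),
      ∀ w : TangentSpace (𝓡 n) x, (e ⟨x, w⟩).2 = L w := fun x hx =>
    ⟨e.continuousLinearEquivAt ℝ x hx, fun w => rfl⟩
  have hx₀ : x₀ ∈ e.baseSet := FiberBundle.mem_baseSet_trivializationAt' x₀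
  have hspan : Submodule.span ℝ (range fun i => (e ⟨x₀, X i x₀⟩).2) = ⊤ := by
    obtain ⟨L, hL⟩ := hlin x₀ hx₀
    simp_rw [hL]
    exact span_range_map_eq_top (hX x₀) L
  have hcomp := (contDiffAt_minimalCoeff hspan (e ⟨x₀, V x₀⟩).2 i).contMDiffAt.comp x₀ hpair
  refine hcomp.congr_of_eventuallyEq ?_
  filter_upwards [e.open_baseSet.mem_nhds hx₀] with x hx
  obtain ⟨L, hL⟩ := hlin x hx
  simp only [Function.comp_apply, hL]
  exact (minimalCoeff_map (hX x) L (V x) i).symm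

theorem finset_sum_apply {ι : Type*} (s : Finset ι) (X : ι → SmoothVectorField n M) (x : M) :
    (∑ i ∈ s, X i) x = ∑ i ∈ s, X i x := by
  classical
  induction s using Finset.induction_on with
  | empty => rfl
  | insert a s ha ih => rw [Finset.sum_insert ha, Finset.sum_insert ha, ← ih]; rfl

/-- Finitely many vector fields that span every tangent space generate the module of vector
fields. -/
theorem SpansTangentSpaces.isGeneratingFamily {ι : Type*} [Fintype ι]
    {X : ι → SmoothVectorField n M} (hX : SpansTangentSpaces X) : IsGeneratingFamily X := by
  refine fun V => ⟨fun i => ⟨_, contMDiff_minimalCoeff hX V i⟩, ContMDiffSection.ext fun x => ?_⟩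
  rw [finset_sum_apply]
  exact (sum_minimalCoeff_smul (E := EuclideanSpace ℝ (Fin n)) (hX x) (V x)).symm

theorem IsGeneratingFamily.moduleFinite {ι : Type*} [Fintype ι]
    {X : ι → SmoothVectorField n M} (hX : IsGeneratingFamily X) :
    Module.Finite (SmoothFunction n M) (SmoothVectorField n M) := by
  rw [Module.finite_def, Submodule.fg_def]
  refine ⟨range X, finite_range X, top_le_iff.1 fun V _ => ?_⟩
  obtain ⟨f, rfl⟩ := hX V
  exact Submodule.sum_mem _ fun i _ =>
    Submodule.smul_mem _ _ (Submodule.subset_span (mem_range_self i))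

end SmoothVectorField

/-! ### Disjoint families from level sets -/

/-- If the level sets `{f i = c i}` of a locally finite family meet at most `n` at a time and the
sets `{c i < f i}` cover the space, then `n + 1` disjoint families of open sets, subordinate to the
supports, cover the space. -/
theorem exists_disjoint_families_of_levels {X ι : Type*} [TopologicalSpace X] {n : ℕ}
    {f : ι → X → ℝ} (hf : ∀ i, Continuous (f i))
    (hfin : LocallyFinite fun i => Function.support (f i)) {c : ι → ℝ} (hc : ∀ i, 1 / 2 < c i)
    (hcover : ∀ x, ∃ i, c i < f i x)
    (hlevel : ∀ j : Fin (n + 1) → ι, Function.Injective j → ∀ x, ∃ k, f (j k) x ≠ c (j k)) :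
    ∃ V : Fin (n + 1) → ι → Set X, (∀ k i, IsOpen (V k i)) ∧
      (∀ k i, V k i ⊆ Function.support (f i)) ∧ (∀ k, Pairwise (Function.onFun Disjoint (V k))) ∧
      ∀ x, ∃ k i, x ∈ V k i := by
  classical
  -- The indices in J are strictly closest to their levels, and i is the first index outside J above
  -- its level. Family k collects the cells with k = |J|.
  let cell (J : Finset ι) (i : ι) : Set X :=
    {y | (∀ l ∉ J, ∀ j ∈ J, |f j y - c j| < |f l y - c l|) ∧ c i < f i y ∧
      ∀ l ∉ J, WellOrderingRel l i → f l y < c l}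
  let V (k : Fin (n + 1)) (i : ι) : Set X :=
    ⋃ (J : Finset ι) (_ : J.card = k ∧ i ∉ J), interior (cell J i)
  have hmem : ∀ {k i x}, x ∈ V k i → ∃ J : Finset ι, J.card = k ∧ i ∉ J ∧ x ∈ cell J i := by
    intro k i x hx
    simp only [V, mem_iUnion] at hx
    obtain ⟨J, ⟨hJ, hi⟩, hx⟩ := hx
    exact ⟨J, hJ, hi, interior_subset hx⟩
  refine ⟨V, fun k i => isOpen_iUnion fun J => isOpen_iUnion fun _ => isOpen_interior,
    fun k i x hx => ?_, fun k i i' hii' => ?_, fun x => ?_⟩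
  · obtain ⟨J, -, -, -, h, -⟩ := hmem hx
    exact ne_of_gt (by linarith [hc i])
  · refine disjoint_left.2 fun x hx hx' => ?_
    obtain ⟨J, hJ, hi, hlt, hpos, hneg⟩ := hmem hx
    obtain ⟨J', hJ', hi', hlt', hpos', hneg'⟩ := hmem hx'
    -- Distinct sets of equal size each have an element outside the other; both cannot be strictly
    -- closer to its level.
    obtain rfl : J = J' := by
      by_contra hne
      obtain ⟨j, hj, hjJ'⟩ := Finset.not_subset.1 fun h =>
        hne (Finset.eq_of_subset_of_card_le h (by omega))
      obtain ⟨l, hl, hlJ⟩ := Finset.not_subset.1 fun h =>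
        hne (Finset.eq_of_subset_of_card_le h (by omega)).symm
      exact lt_asymm (hlt l hlJ j hj) (hlt' j hjJ' l hl)
    rcases trichotomous_of WellOrderingRel i i' with h | h | h
    · exact lt_asymm hpos (hneg' i hi h)
    · exact hii' h
    · exact lt_asymm hpos' (hneg i' hi' h)
  -- Take J to be all indices exactly at their level at x, and i the first one above.
  · have hJfin : {i | f i x = c i}.Finite :=
      (hfin.point_finite x).subset fun i hi => ne_of_gt (by
        have : f i x = c i := hi
        linarith [hc i])
    set J := hJfin.toFinset with hJdef
    have hJ : ∀ {i}, i ∈ J ↔ f i x = c i := by simp [hJdef]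
    have hcard : J.card < n + 1 := by
      by_contra! hle
      obtain ⟨T, hTJ, hT⟩ := Finset.exists_subset_card_eq hle
      obtain ⟨k, hk⟩ := hlevel (fun k => (T.equivFinOfCardEq hT).symm k)
        (Subtype.val_injective.comp (Equiv.injective _)) x
      exact hk (hJ.1 (hTJ (Subtype.prop _)))
    let i := WellOrderingRel.isWellOrder.wf.min {i | c i < f i x} (hcover x)
    have hi : c i < f i x := WellFounded.min_mem _ _ (hcover x)
    have hneg : ∀ l ∉ J, WellOrderingRel l i → f l x < c l := fun l hl hli =>
      lt_of_le_of_ne (not_lt.1 fun h => WellFounded.not_lt_min _ (s := {i | c i < f i x}) h hli) (mt hJ.2 hl)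
    have hiJ : i ∉ J := fun h => hi.ne' (hJ.1 h)
    have hsmall : ∀ᶠ y in 𝓝 x, ∀ j ∈ J, |f j y - c j| < 1 / 2 := by
      rw [Filter.eventually_all_finset]
      intro j hj
      refine ((hf j).sub continuous_const).abs.continuousAt.eventually_lt continuousAt_const ?_
      simp [hJ.1 hj]
    have hnear : ∀ᶠ y in 𝓝 x, ∀ l, l ∉ J →
        (∀ j ∈ J, |f j y - c j| < 1 / 2 → |f j y - c j| < |f l y - c l|) ∧
          (WellOrderingRel l i → f l y < c l) := by
      obtain ⟨t, ht, htfin⟩ := hfin x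
      have hfinite : ∀ᶠ y in 𝓝 x, ∀ l ∈ htfin.toFinset, l ∉ J →
          (∀ j ∈ J, |f j y - c j| < 1 / 2 → |f j y - c j| < |f l y - c l|) ∧
          (WellOrderingRel l i → f l y < c l) := by
        rw [Filter.eventually_all_finset]
        intro l _
        by_cases hl : l ∈ J
        · exact Eventually.of_forall fun y h => absurd hl h
        have h1 : ∀ᶠ y in 𝓝 x, ∀ j ∈ J, |f j y - c j| < |f l y - c l| := by
          rw [Filter.eventually_all_finset]
          intro j hj
          refine ((hf j).sub continuous_const).abs.continuousAt.eventually_lt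
            ((hf l).sub continuous_const).abs.continuousAt ?_
          simpa [hJ.1 hj, sub_eq_zero] using mt hJ.2 hl
        have h2 : ∀ᶠ y in 𝓝 x, WellOrderingRel l i → f l y < c l := by
          by_cases hli : WellOrderingRel l i
          · filter_upwards [(hf l).continuousAt.eventually_lt continuousAt_const (hneg l hl hli)]
              with y hy _ using hy
          · exact Eventually.of_forall fun y h => absurd h hli
        filter_upwards [h1, h2] with y hy1 hy2 _ using ⟨fun j hj _ => hy1 j hj, hy2⟩
      filter_upwards [hfinite, ht] with y hy hyt l hl
      by_cases hlt : l ∈ htfin.toFinset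
      · exact hy l hlt hl
      have h0 : f l y = 0 := by
        by_contra h
        exact hlt (htfin.mem_toFinset.2 ⟨y, h, hyt⟩)
      -- A vanishing f l is at distance c l > 1/2 from its level, which handles all but finitely
      -- many l at once.
      have hcl := hc l
      rw [h0, zero_sub, abs_neg, abs_of_pos (by linarith)]
      exact ⟨fun j _ h => by linarith, fun _ => by linarith⟩
    refine ⟨⟨J.card, hcard⟩, i, ?_⟩
    simp only [V, mem_iUnion]
    refine ⟨J, ⟨rfl, hiJ⟩, mem_interior_iff_mem_nhds.2 ?_⟩
    filter_upwards [hsmall, hnear, continuousAt_const.eventually_lt (hf i).continuousAt hi]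
      with y hy1 hy2 hy3
    exact ⟨fun l hl j hj => (hy2 l hl).1 j hj (hy1 j hj), hy3, fun l hl => (hy2 l hl).2⟩

/-! ### Levels in general position -/

section Levels

variable {n : ℕ} {M : Type*} [TopologicalSpace M] [SecondCountableTopology M]
  [ChartedSpace (EuclideanSpace ℝ (Fin n)) M] [IsManifold (𝓡 n) 1 M]

/-- The range of a `C^1` map on a second countable `n`-manifold has Hausdorff dimension at most
`n`. -/
theorem ContMDiff.dimH_range_le {F : Type*} [NormedAddCommGroup F] [NormedSpace ℝ F]
    {g : M → F} (hg : ContMDiff (𝓡 n) 𝓘(ℝ, F) 1 g) : dimH (range g) ≤ n := by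
  obtain ⟨s, hs, hcover⟩ := TopologicalSpace.countable_cover_nhds fun x : M =>
    (chartAt (EuclideanSpace ℝ (Fin n)) x).open_source.mem_nhds (mem_chart_source _ x)
  have hrange : range g ⊆ ⋃ x ∈ s, (g ∘ (chartAt (EuclideanSpace ℝ (Fin n)) x).symm) ''
      (chartAt (EuclideanSpace ℝ (Fin n)) x).target := by
    rintro _ ⟨y, rfl⟩
    obtain ⟨x, hx, hy⟩ := mem_iUnion₂.1 (hcover.symm ▸ mem_univ y)
    refine mem_iUnion₂.2 ⟨x, hx, _, (chartAt _ x).map_source hy, ?_⟩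
    rw [Function.comp_apply, (chartAt _ x).left_inv hy]
  refine (dimH_mono hrange).trans ?_
  rw [dimH_bUnion hs]
  refine iSup₂_le fun x _ => ?_
  have hcd : ContDiffOn ℝ 1 (g ∘ (chartAt (EuclideanSpace ℝ (Fin n)) x).symm)
      (chartAt (EuclideanSpace ℝ (Fin n)) x).target :=
    contMDiffOn_iff_contDiffOn.1 (hg.comp_contMDiffOn contMDiffOn_chart_symm)
  -- C¹ maps are locally Lipschitz, so they do not raise Hausdorff dimension.
  refine (dimH_image_le_of_locally_lipschitzOn fun y hy => ?_).trans
    ((dimH_mono (subset_univ _)).trans ?_)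
  · obtain ⟨K, t, ht, hK⟩ := (hcd.contDiffAt ((chartAt _ x).open_target.mem_nhds hy)
      ).exists_lipschitzOnWith
    exact ⟨K, t, nhdsWithin_le_nhds ht, hK⟩
  · simp [Real.dimH_univ_eq_finrank]

/-- Any c can be moved into the set by perturbing only its coordinates along `j`. -/
theorem Dense.preimage_precomp {κ ι Y : Type*} [TopologicalSpace Y] {D : Set (κ → Y)}
    (hD : Dense D) {j : κ → ι} (hj : Function.Injective j) :
    Dense {c : ι → Y | c ∘ j ∈ D} := by
  intro c
  have hcont : Continuous fun t : κ → Y => Function.extend j t c := by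
    refine continuous_pi fun i => ?_
    by_cases hi : ∃ k, j k = i
    · obtain ⟨k, rfl⟩ := hi
      simpa only [hj.extend_apply] using continuous_apply k
    · simpa only [Function.extend_apply' _ _ _ hi] using continuous_const
  have hc : Function.extend j (c ∘ j) c = c := by
    funext i
    by_cases hi : ∃ k, j k = i
    · obtain ⟨k, rfl⟩ := hi
      exact hj.extend_apply _ _ k
    · exact Function.extend_apply' _ _ _ hi
  have h := image_closure_subset_closure_image hcont (mem_image_of_mem _ (hD (c ∘ j)))
  rw [hc] at h
  refine closure_mono ?_ h
  rintro _ ⟨t, ht, rfl⟩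
  simpa [Function.extend_comp hj] using ht

/-- Levels in a given open set can be chosen for countably many functions on an `n`-manifold
such that no point lies on `n + 1` of the level sets. -/
theorem exists_levels_in_general_position {ι : Type*} [Countable ι] {f : ι → M → ℝ}
    (hf : ∀ i, ContMDiff (𝓡 n) 𝓘(ℝ, ℝ) 1 (f i)) {O : Set ℝ} (hO : IsOpen O) (hne : O.Nonempty) :
    ∃ c : ι → ℝ, (∀ i, c i ∈ O) ∧
      ∀ j : Fin (n + 1) → ι, Function.Injective j → ∀ x, ∃ k, f (j k) x ≠ c (j k) := by
  have := ChartedSpace.locallyCompactSpace (EuclideanSpace ℝ (Fin n)) M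
  have : PolishSpace O := hO.polishSpace
  have : Nonempty O := hne.to_subtype
  let G (j : Fin (n + 1) → ι) (x : M) : Fin (n + 1) → ℝ := fun k => f (j k) x
  have hG : ∀ j, ContMDiff (𝓡 n) 𝓘(ℝ, Fin (n + 1) → ℝ) 1 (G j) := fun j =>
    contMDiff_pi_space.2 fun k => hf (j k)
  -- Compact pieces make the avoided images closed, and there are countably many p, so Baire applies
  -- in the Polish space `ι → O`.
  let A (p : {j : Fin (n + 1) → ι // Function.Injective j} × ℕ) : Set (ι → O) :=
    {c | c ∘ p.1.1 ∈ {t : Fin (n + 1) → O |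
      (fun k => (t k : ℝ)) ∈ (G p.1.1 '' compactCovering M p.2)ᶜ}}
  have hclosed : ∀ j m, IsClosed (G j '' compactCovering M m) := fun j m =>
    ((isCompact_compactCovering M m).image (hG j).continuous).isClosed
  have hopen : ∀ p, IsOpen (A p) := fun p =>
    (hclosed p.1.1 p.2).isOpen_compl.preimage
      (f := fun (c : ι → O) k => ((c (p.1.1 k) : O) : ℝ)) (by fun_prop)
  have hdense : ∀ p, Dense (A p) := fun p => by
    refine Dense.preimage_precomp ?_ p.1.2
    have hD : Dense (G p.1.1 '' compactCovering M p.2)ᶜ := by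
      refine dense_compl_of_dimH_lt_finrank ?_
      refine ((dimH_mono (image_subset_range _ _)).trans (hG _).dimH_range_le).trans_lt ?_
      simp only [Module.finrank_fintype_fun_eq_card, Fintype.card_fin]
      exact_mod_cast n.lt_succ_self
    exact hD.preimage (f := fun (t : Fin (n + 1) → O) k => (t k : ℝ))
      (IsOpenMap.piMap (fun _ => hO.isOpenMap_subtype_val) (by simp))
  obtain ⟨c, hc⟩ := (dense_iInter_of_isOpen hopen hdense).nonempty
  refine ⟨fun i => c i, fun i => (c i).2, fun j hj x => ?_⟩
  by_contra! h
  obtain ⟨m, hm⟩ := mem_iUnion.1 ((iUnion_compactCovering M).symm ▸ mem_univ x)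
  exact mem_iInter.1 hc (⟨j, hj⟩, m) ⟨x, hm, funext h⟩

end Levels

/-! ### Trivialising covers and global fields -/

section TrivialisingCover

variable {n : ℕ} {M : Type*} [TopologicalSpace M]
  [ChartedSpace (EuclideanSpace ℝ (Fin n)) M] [IsManifold (𝓡 n) ∞ M]

/-- Local frames over disjoint open sets glue to a local frame over the union. -/
theorem exists_isLocalFrameOn_iUnion {ι κ : Type*} {V : ι → Set M} (hV : ∀ i, IsOpen (V i))
    (hdisj : Pairwise (Function.onFun Disjoint V))
    {E : ι → κ → (x : M) → TangentSpace (𝓡 n) x}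
    (hE : ∀ i, IsLocalFrameOn (𝓡 n) (EuclideanSpace ℝ (Fin n)) ∞ (E i) (V i)) :
    ∃ F : κ → (x : M) → TangentSpace (𝓡 n) x,
      IsLocalFrameOn (𝓡 n) (EuclideanSpace ℝ (Fin n)) ∞ F (⋃ i, V i) := by
  classical
  let F (a : κ) (x : M) : TangentSpace (𝓡 n) x :=
    if h : ∃ i, x ∈ V i then E h.choose a x else 0
  have hF : ∀ i, ∀ x ∈ V i, ∀ a, F a x = E i a x := by
    intro i x hx a
    have h : ∃ i, x ∈ V i := ⟨i, hx⟩
    have hi : h.choose = i := by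
      by_contra hne
      exact disjoint_left.1 (hdisj hne) h.choose_spec hx
    simp only [F, dif_pos h, hi]
  have hFi : ∀ i, IsLocalFrameOn (𝓡 n) (EuclideanSpace ℝ (Fin n)) ∞ F (V i) := fun i =>
    (hE i).congr fun a x hx => (hF i x hx a).symm
  refine ⟨F, ⟨fun {x} hx => ?_, fun {x} hx => ?_, fun a x hx => ?_⟩⟩ <;>
    obtain ⟨i, hi⟩ := mem_iUnion.1 hx
  · exact (hFi i).linearIndependent hi
  · exact (hFi i).generating hi
  · exact ((hFi i).contMDiffAt (hV i) hi a).contMDiffWithinAt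

/-- A second countable Hausdorff `n`-manifold has a trivialising cover by `n + 1` open sets. -/
theorem exists_isTrivialisingCover [T2Space M] [SecondCountableTopology M] :
    ∃ (U : Fin (n + 1) → Set M) (E : Fin (n + 1) → Fin n → (x : M) → TangentSpace (𝓡 n) x),
      IsTrivialisingCover U E := by
  have := ChartedSpace.locallyCompactSpace (EuclideanSpace ℝ (Fin n)) M
  have : IsManifold (𝓡 n) 1 M := .of_le (n := ∞) (by simp)
  obtain ⟨ι, f, -⟩ := SmoothBumpCovering.exists_isSubordinate (𝓡 n) (isClosed_univ (X := M))
    (U := fun _ => univ) fun _ _ => univ_mem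
  have : Countable ι := countable_univ_iff.1
    (f.locallyFinite.countable_univ fun i => (f i).nonempty_support)
  -- Levels exceed 1/2 for the cell construction and stay below 1 because some bump equals 1 at each
  -- point.
  obtain ⟨c, hc, hlevel⟩ := exists_levels_in_general_position (n := n) (f := fun i => f i)
    (fun i => (f i).contMDiff.of_le (by simp)) (isOpen_Ioo (a := (1 / 2 : ℝ)) (b := 1))
    ⟨3 / 4, by norm_num⟩
  obtain ⟨V, hopen, hsub, hdisj, hcover⟩ := exists_disjoint_families_of_levels
    (fun i => (f i).continuous) f.locallyFinite (fun i => (hc i).1)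
    (fun x => ⟨f.ind x (mem_univ x), by rw [f.apply_ind]; exact (hc _).2⟩) hlevel
  have hframe : ∀ k, ∃ E : Fin n → (x : M) → TangentSpace (𝓡 n) x,
      IsLocalFrameOn (𝓡 n) (EuclideanSpace ℝ (Fin n)) ∞ E (⋃ i, V k i) := fun k =>
    exists_isLocalFrameOn_iUnion (hopen k) (hdisj k) fun i =>
      ((trivializationAt (EuclideanSpace ℝ (Fin n)) (TangentSpace (𝓡 n) (M := M))
        (f.c i)).isLocalFrameOn_localFrame_baseSet (𝓡 n) ∞
        (EuclideanSpace.basisFun (Fin n) ℝ).toBasis).mono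
          ((hsub k i).trans (f i).support_subset_source)
  choose E hE using hframe
  refine ⟨fun k => ⋃ i, V k i, E, fun k => isOpen_iUnion (hopen k), ?_, hE⟩
  refine eq_univ_of_forall fun x => ?_
  obtain ⟨k, i, h⟩ := hcover x
  exact mem_iUnion.2 ⟨k, mem_iUnion.2 ⟨i, h⟩⟩

namespace IsTrivialisingCover

variable {ι : Type*} {U : ι → Set M} {E : ι → Fin n → (x : M) → TangentSpace (𝓡 n) x}

theorem exists_smoothPartitionOfUnity [T2Space M] [SecondCountableTopology M]
    (hU : IsTrivialisingCover U E) :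
    ∃ ψ : SmoothPartitionOfUnity ι (𝓡 n) M, ψ.IsSubordinate U := by
  have := ChartedSpace.locallyCompactSpace (EuclideanSpace ℝ (Fin n)) M
  exact SmoothPartitionOfUnity.exists_isSubordinate (𝓡 n) isClosed_univ U hU.isOpen
    hU.iUnion_eq.ge

/-- The products of the frames of a trivialising cover with a subordinate partition of unity are
smooth vector fields that span every tangent space. -/
theorem exists_spansTangentSpaces [Fintype ι] (hU : IsTrivialisingCover U E)
    {ψ : SmoothPartitionOfUnity ι (𝓡 n) M} (hψ : ψ.IsSubordinate U) :
    ∃ X : ι × Fin n → SmoothVectorField n M,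
      (∀ i j x, X (i, j) x = ψ i x • E i j x) ∧ SmoothVectorField.SpansTangentSpaces X := by
  refine ⟨fun p => ⟨fun x => ψ p.1 x • E p.1 p.2 x,
    ContMDiffOn.smul_section_of_tsupport (ψ p.1).contMDiff.contMDiffOn (hU.isOpen p.1) (hψ p.1)
      ((hU.isLocalFrameOn p.1).contMDiffOn p.2)⟩, fun i j x => rfl, fun x => ?_⟩
  -- Where ψ i x > 0, the cut-off fields are nonzero multiples of a frame at x.
  obtain ⟨i, hi⟩ := ψ.exists_pos_of_mem (mem_univ x)
  have hxU : x ∈ U i := hψ i (subset_closure hi.ne')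
  refine top_le_iff.1 (((hU.isLocalFrameOn i).generating hxU).trans (Submodule.span_le.2 ?_))
  rintro _ ⟨j, rfl⟩
  have h := Submodule.smul_mem _ (ψ i x)⁻¹ (Submodule.subset_span (R := ℝ)
    (mem_range_self (f := fun p : ι × Fin n => ψ p.1 x • E p.1 p.2 x) (i, j)))
  simp only [smul_smul, inv_mul_cancel₀ hi.ne', one_smul] at h
  exact h

end IsTrivialisingCover

end TrivialisingCover

theorem mainTheorem4 (n : ℕ) (M : Type*) [TopologicalSpace M] [T2Space M]
    [ChartedSpace (EuclideanSpace ℝ (Fin n)) M] [IsManifold (𝓡 n) ∞ M] :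
    -- finitely many vector fields that span every tangent space form a generating set
    (∀ (m : ℕ) (X : Fin m → SmoothVectorField n M),
      SmoothVectorField.SpansTangentSpaces X → SmoothVectorField.IsGeneratingFamily X) ∧
    (SecondCountableTopology M →
      -- the module of smooth vector fields is finitely generated
      Module.Finite (SmoothFunction n M) (SmoothVectorField n M) ∧
      -- there is a trivialising cover by `n + 1` open sets
      (∃ (U : Fin (n + 1) → Set M)
          (E : Fin (n + 1) → Fin n → (x : M) → TangentSpace (𝓡 n) x),
        IsTrivialisingCover U E) ∧
      -- for each such cover, with its local frames, there is a smooth partition of unity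
      -- subordinate to it, and each one multiplies the frames to global smooth vector fields
      -- that span every tangent space and form a generating set
      (∀ (U : Fin (n + 1) → Set M)
          (E : Fin (n + 1) → Fin n → (x : M) → TangentSpace (𝓡 n) x),
        IsTrivialisingCover U E →
          (∃ ψ : SmoothPartitionOfUnity (Fin (n + 1)) (𝓡 n) M, ψ.IsSubordinate U) ∧
          ∀ ψ : SmoothPartitionOfUnity (Fin (n + 1)) (𝓡 n) M, ψ.IsSubordinate U →
            ∃ X : Fin (n + 1) × Fin n → SmoothVectorField n M,
              (∀ i j x, X (i, j) x = ψ i x • E i j x) ∧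
              SmoothVectorField.SpansTangentSpaces X ∧
              SmoothVectorField.IsGeneratingFamily X)) := by
  refine ⟨fun m X hX => hX.isGeneratingFamily, fun _ => ?_⟩
  obtain ⟨U, E, hU⟩ := exists_isTrivialisingCover (n := n) (M := M)
  obtain ⟨ψ, hψ⟩ := hU.exists_smoothPartitionOfUnity
  obtain ⟨X, -, hX⟩ := hU.exists_spansTangentSpaces hψ
  refine ⟨hX.isGeneratingFamily.moduleFinite, ⟨U, E, hU⟩, fun U E hU =>
    ⟨hU.exists_smoothPartitionOfUnity, fun ψ hψ => ?_⟩⟩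
  obtain ⟨X, hXE, hX⟩ := hU.exists_spansTangentSpaces hψ
  exact ⟨X, hXE, hX, hX.isGeneratingFamily⟩
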